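/- Let $t_1,t_2,\dots$ be commuting indeterminates and consider the formal power series over $\mathbb{Q}$ \[ E=\Bigl(\prod_{j\ge 1}\exp(t_{2j-1})\Bigr)\cosh\Bigl(\sum_{j\ge 1}\Bigl(\tfrac{2j-1}{2}\,t_{2j-1}^2+j\,t_{2j}^2\Bigr)\Bigr), \qquad O=\Bigl(\prod_{j\ge 1}\exp(t_{2j-1})\Bigr)\sinh\Bigl(\sum_{j\ge 1}\Bigl(\tfrac{2j-1}{2}\,t_{2j-1}^2+j\,t_{2j}^2\Bigr)\Bigr), \] where the infinite product and the infinite sum converge formally (each coefficient is eventually constant along the finite partial products and sums). Let $\sigma$ be a permutation of $n$ letters with cycle type $\mathbf c=(c_1,\dots,c_n)$, that is, for each $i\in\{1,\dots,n\}$ the permutation $\sigma$ has exactly $c_i$ cycles of length $i$, fixed points being cycles of length $1$ (so $c_1+2c_2+\cdots+nc_n=n$). Then the coefficient of $\dfrac{t_1^{c_1}\cdots t_n^{c_n}}{c_1!\cdots c_n!}$ in $E$ is the number of even permutations $\tau$ of the $n$ letters with $\tau^2=\sigma$, and the coefficient of $\dfrac{t_1^{c_1}\cdots t_n^{c_n}}{c_1!\cdots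 c_n!}$ in $O$ is the number of odd permutations $\tau$ of the $n$ letters with $\tau^2=\sigma$. -/

import Mathlib

open scoped Nat

/-- Formal power series over `ℚ` in the variables `t ℓ`; only the `t ℓ` with `1 ≤ ℓ` occur below. -/
abbrev Series : Type := MvPowerSeries ℕ ℚ

/-- Formal convergence: every coefficient is eventually constant, that is, the topology of
coefficientwise convergence for the discrete topology on `ℚ`. -/
@[reducible] noncomputable def formalTopology : TopologicalSpace Series :=
  letI : TopologicalSpace ℚ := ⊥
  MvPowerSeries.WithPiTopology.instTopologicalSpace ℚ

attribute [local instance] formalTopology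

/-- The variable `t_ℓ`. -/
noncomputable def t (ℓ : ℕ) : Series := MvPowerSeries.X ℓ

/-- The power series of `cosh`. -/
noncomputable def coshSeries : PowerSeries ℚ :=
  PowerSeries.mk fun m => if Even m then 1 / (m ! : ℚ) else 0

/-- The power series of `sinh`. -/
noncomputable def sinhSeries : PowerSeries ℚ :=
  PowerSeries.mk fun m => if Odd m then 1 / (m ! : ℚ) else 0

/-- `exp (t_{2j-1})` for `j ≥ 1`, with `j - 1` as the index. -/
noncomputable def expFactor (j : ℕ) : Series :=
  (PowerSeries.exp ℚ).subst (t (2 * j + 1))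

/-- `(2j-1)/2 * t_{2j-1}^2 + j * t_{2j}^2` for `j ≥ 1`, with `j - 1` as the index. -/
noncomputable def squareTerm (j : ℕ) : Series :=
  ((2 * (j : ℚ) + 1) / 2) • t (2 * j + 1) ^ 2 + ((j : ℚ) + 1) • t (2 * j + 2) ^ 2

/-- `∏_{j ≥ 1} exp (t_{2j-1}) * cosh (∑_{j ≥ 1} ((2j-1)/2 * t_{2j-1}^2 + j * t_{2j}^2))`. -/
noncomputable def evenRootSeries : Series :=
  (∏' j, expFactor j) * coshSeries.subst (∑' j, squareTerm j)

/-- `∏_{j ≥ 1} exp (t_{2j-1}) * sinh (∑_{j ≥ 1} ((2j-1)/2 * t_{2j-1}^2 + j * t_{2j}^2))`. -/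
noncomputable def oddRootSeries : Series :=
  (∏' j, expFactor j) * sinhSeries.subst (∑' j, squareTerm j)

/-- The coefficient of `t_1^{c_1} ⋯ t_n^{c_n} / (c_1! ⋯ c_n!)` in `F`, where `c_{i+1}` is `c i`. -/
noncomputable def egfCoeff {n : ℕ} (c : Fin n → ℕ) (F : Series) : ℚ :=
  (∏ i, ((c i)! : ℚ)) *
    MvPowerSeries.coeff (∑ i : Fin n, Finsupp.single ((i : ℕ) + 1) (c i)) F

/-- `σ` has exactly `c i` cycles of length `i + 1` for every `i`, where fixed points are cycles of
length `1` (`Equiv.Perm.partition` counts them, `Equiv.Perm.cycleType` does not). -/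
def HasCycleVector {n : ℕ} (σ : Equiv.Perm (Fin n)) (c : Fin n → ℕ) : Prop :=
  ∀ i : Fin n, σ.partition.parts.count ((i : ℕ) + 1) = c i

/-- The even square roots of `σ`. -/
def evenSquareRoots {n : ℕ} (σ : Equiv.Perm (Fin n)) : Finset (Equiv.Perm (Fin n)) :=
  {τ | τ ^ 2 = σ ∧ Equiv.Perm.sign τ = 1}

/-- The odd square roots of `σ`. -/
def oddSquareRoots {n : ℕ} (σ : Equiv.Perm (Fin n)) : Finset (Equiv.Perm (Fin n)) :=
  {τ | τ ^ 2 = σ ∧ Equiv.Perm.sign τ = -1}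

/-! Write R_u for E when u = 1 and for O when u = -1. Differentiation fixes `exp` and exchanges
`cosh` and `sinh`, so ∂R_u/∂t_i = [i odd] R_u + i t_i R_{-u} for i ≥ 1. Read on coefficients of
t^d/d!, this is the recursion `expCoeff_rootSeries_add_single`.

Square roots obey the same recursion (`card_signedSquareRoots_eq_sum`). Fix a point a in an i-cycle
of σ, let d count the other cycles, and let τ² = σ. If τ a lies in the cycle of a, then i is odd and
τ is σ^((i+1)/2) there, an even permutation. Otherwise b = τ a is one of the i·d_i points on the
other i-cycles, and τ interleaves the two cycles into a 2i-cycle, which is odd. In both cases τ is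
an arbitrary square root on the complement, of prescribed sign (`card_signedSquareRoots_extending`).
Induction on the number of points concludes; the empty set matches the constant coefficients. -/

open Filter

/-! ### Substitution and the chain rule -/

theorem coeff_pow_eq_zero_of_degree_lt {a : Series} (ha : MvPowerSeries.constantCoeff a = 0)
    {e : ℕ →₀ ℕ} {n : ℕ} (h : e.degree < n) : MvPowerSeries.coeff e (a ^ n) = 0 := by
  refine MvPowerSeries.coeff_of_lt_order (lt_of_lt_of_le (by exact_mod_cast h)
    (MvPowerSeries.le_order_pow_of_constantCoeff_eq_zero n ha))

/-- Since `a ^ m` has order at least `m`, the sum may be cut at any bound above the degree; a common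
bound lets sums be interchanged. -/
theorem coeff_subst_eq_sum_range {a : Series} (ha : MvPowerSeries.constantCoeff a = 0)
    (f : PowerSeries ℚ) {e : ℕ →₀ ℕ} {n : ℕ} (h : e.degree < n) :
    MvPowerSeries.coeff e (f.subst a) =
      ∑ m ∈ Finset.range n, PowerSeries.coeff m f * MvPowerSeries.coeff e (a ^ m) := by
  rw [PowerSeries.coeff_subst (PowerSeries.HasSubst.of_constantCoeff_zero ha)]
  refine finsum_eq_sum_of_support_subset _ fun m hm => ?_
  by_contra hmn
  refine hm ?_
  simp only [Finset.coe_range, Set.mem_Iio, not_lt] at hmn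
  simp only [coeff_pow_eq_zero_of_degree_lt ha (h.trans_le hmn), smul_zero]

/-- The chain rule for substituting a multivariate power series into a univariate one. -/
theorem pderiv_subst {a : Series} (ha : MvPowerSeries.constantCoeff a = 0)
    (f : PowerSeries ℚ) (i : ℕ) :
    MvPowerSeries.pderiv ℚ i (f.subst a) =
      (PowerSeries.derivative ℚ f).subst a * MvPowerSeries.pderiv ℚ i a := by
  classical
  ext d
  -- One more than needed for `d + single i 1`: splitting off `m = 0` leaves exactly the range
  -- `d.degree + 1` used for the derived series.
  have h1 : (d + Finsupp.single i 1).degree < d.degree + 2 := by simp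
  rw [MvPowerSeries.coeff_pderiv, coeff_subst_eq_sum_range ha f h1, MvPowerSeries.coeff_mul,
    Finset.sum_mul, Finset.sum_range_succ']
  have h2 : ∀ x ∈ Finset.HasAntidiagonal.antidiagonal d,
      MvPowerSeries.coeff x.1 ((PowerSeries.derivative ℚ f).subst a) *
        MvPowerSeries.coeff x.2 (MvPowerSeries.pderiv ℚ i a) =
      ∑ m ∈ Finset.range (d.degree + 1), PowerSeries.coeff m (PowerSeries.derivative ℚ f) *
        (MvPowerSeries.coeff x.1 (a ^ m) *
          MvPowerSeries.coeff x.2 (MvPowerSeries.pderiv ℚ i a)) := by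
    intro x hx
    have h3 : x.1.degree < d.degree + 1 := by
      rw [← Finset.HasAntidiagonal.mem_antidiagonal.1 hx, map_add]
      omega
    rw [coeff_subst_eq_sum_range ha _ h3, Finset.sum_mul]
    exact Finset.sum_congr rfl fun m _ => mul_assoc _ _ _
  rw [Finset.sum_congr rfl h2, Finset.sum_comm]
  simp_rw [← Finset.mul_sum, ← MvPowerSeries.coeff_mul]
  have h4 : MvPowerSeries.coeff (d + Finsupp.single i 1) (a ^ 0) = 0 := by
    rw [pow_zero, MvPowerSeries.coeff_one, if_neg]
    intro h
    simpa using DFunLike.congr_fun h i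
  rw [h4, mul_zero, zero_mul, add_zero]
  refine Finset.sum_congr rfl fun m _ => ?_
  rw [mul_assoc, ← MvPowerSeries.coeff_pderiv, MvPowerSeries.pderiv_pow,
    PowerSeries.coeff_derivative, Nat.add_sub_cancel, mul_assoc, ← nsmul_eq_mul, map_nsmul,
    nsmul_eq_mul]
  push_cast
  ring

/-! ### Derivatives of the building blocks -/

theorem constantCoeff_t (ℓ : ℕ) : MvPowerSeries.constantCoeff (t ℓ) = 0 := by simp [t]

theorem derivative_exp : PowerSeries.derivative ℚ (PowerSeries.exp ℚ) = PowerSeries.exp ℚ := by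
  ext n
  simp [PowerSeries.coeff_derivative, PowerSeries.coeff_exp, Nat.factorial_succ]
  field_simp

theorem derivative_coshSeries : PowerSeries.derivative ℚ coshSeries = sinhSeries := by
  ext n
  simp only [PowerSeries.coeff_derivative, coshSeries, sinhSeries, PowerSeries.coeff_mk,
    Nat.even_add_one, Nat.not_even_iff_odd, Nat.factorial_succ]
  split_ifs <;> simp
  field_simp

theorem derivative_sinhSeries : PowerSeries.derivative ℚ sinhSeries = coshSeries := by
  ext n
  simp only [PowerSeries.coeff_derivative, coshSeries, sinhSeries, PowerSeries.coeff_mk,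
    Nat.odd_add_one, Nat.not_odd_iff_even, Nat.factorial_succ]
  split_ifs <;> simp
  field_simp

theorem pderiv_expFactor (i j : ℕ) :
    MvPowerSeries.pderiv ℚ i (expFactor j) = if 2 * j + 1 = i then expFactor j else 0 := by
  rw [expFactor, pderiv_subst (constantCoeff_t _), derivative_exp, t]
  split_ifs with h
  · subst h; simp
  · rw [MvPowerSeries.pderiv_X_of_ne h, mul_zero]

theorem pderiv_squareTerm (i j : ℕ) :
    MvPowerSeries.pderiv ℚ i (squareTerm j) =
      if 2 * j + 1 = i ∨ 2 * j + 2 = i then (i : ℚ) • t i else 0 := by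
  have key : ∀ ℓ : ℕ, MvPowerSeries.pderiv ℚ i (t ℓ ^ 2) = if ℓ = i then (2 : ℚ) • t i else 0 := by
    intro ℓ
    rw [MvPowerSeries.pderiv_pow, t]
    split_ifs with h
    · subst h; simp [t, two_smul, two_mul]
    · rw [MvPowerSeries.pderiv_X_of_ne h, mul_zero]
  rw [squareTerm, map_add, Derivation.map_smul, Derivation.map_smul, key, key]
  by_cases h1 : 2 * j + 1 = i
  · have h2 : ¬ 2 * j + 2 = i := by omega
    rw [if_pos h1, if_neg h2, if_pos (Or.inl h1), smul_zero, add_zero, smul_smul, ← h1]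
    congr 1; push_cast; ring
  · by_cases h2 : 2 * j + 2 = i
    · rw [if_neg h1, if_pos h2, if_pos (Or.inr h2), smul_zero, zero_add, smul_smul, ← h2]
      congr 1; push_cast; ring
    · rw [if_neg h1, if_neg h2, if_neg (by tauto)]; simp

/-! ### Formal convergence and derivatives of the infinite product and sum -/

/-- Giving `t ℓ` weight `ℓ` makes the order of `expFactor j - 1` at least `2 * j + 1`. The ordinary
order would not do: it is 1 for every `j`. -/
theorem multipliable_expFactor : Multipliable expFactor := by
  let _ : TopologicalSpace ℚ := ⊥
  have := MvPowerSeries.WithPiTopology.multipliable_one_add_of_tendsto_weightedOrder_atTop_nhds_top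
    (σ := ℕ) (R := ℚ) (f := fun j => expFactor j - 1) (w := id) ?_
  · simpa using this
  · rw [ENat.tendsto_nhds_top_iff_natCast_lt]
    intro n
    filter_upwards [eventually_ge_atTop n] with j hj
    refine lt_of_lt_of_le (b := ((2 * j + 1 : ℕ) : ℕ∞)) (by exact_mod_cast (by omega)) ?_
    refine MvPowerSeries.le_weightedOrder _ fun d hd => ?_
    classical
    rw [map_sub, expFactor, t, PowerSeries.coeff_subst_single, MvPowerSeries.coeff_one]
    by_cases h0 : d = 0
    · subst h0; simp
    · rw [if_neg h0, if_neg, sub_zero]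
      intro h
      rw [h] at hd
      have : d (2 * j + 1) ≠ 0 := fun h' => h0 (by rw [h, h', Finsupp.single_zero])
      simp [Finsupp.weight_single] at hd
      have h2 : (2 * j + 1) ≤ d (2 * j + 1) * (2 * j + 1) := Nat.le_mul_of_pos_left _ (by omega)
      norm_cast at hd
      omega

theorem summable_squareTerm : Summable squareTerm := by
  let _ : TopologicalSpace ℚ := ⊥
  refine MvPowerSeries.WithPiTopology.summable_of_tendsto_weightedOrder_atTop_nhds_top
    (σ := ℕ) (R := ℚ) (w := id) ?_
  rw [ENat.tendsto_nhds_top_iff_natCast_lt]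
  intro n
  filter_upwards [eventually_ge_atTop n] with j hj
  refine lt_of_lt_of_le (b := ((2 * j + 1 : ℕ) : ℕ∞)) (by exact_mod_cast (by omega)) ?_
  refine MvPowerSeries.le_weightedOrder _ fun d hd => ?_
  classical
  have key : ∀ ℓ : ℕ, 2 * j + 1 ≤ ℓ → MvPowerSeries.coeff d (t ℓ ^ 2) = 0 := by
    intro ℓ hℓ
    rw [t, MvPowerSeries.coeff_X_pow, if_neg]
    rintro rfl
    simp [Finsupp.weight_single] at hd
    norm_cast at hd
    omega
  simp [squareTerm, key]

/-- In a discrete space convergence is eventual equality, so each coefficient can be computed on a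
finite partial product. -/
theorem eventually_coeff_prod (d : ℕ →₀ ℕ) :
    ∀ᶠ s in (atTop : Filter (Finset ℕ)),
      MvPowerSeries.coeff d (∏ j ∈ s, expFactor j) =
        MvPowerSeries.coeff d (∏' j, expFactor j) := by
  let _ : TopologicalSpace ℚ := ⊥
  have : DiscreteTopology ℚ := ⟨rfl⟩
  have h := multipliable_expFactor.hasProd
  have h2 := (MvPowerSeries.WithPiTopology.tendsto_iff_coeff_tendsto _ _ _).1 h d
  rw [nhds_discrete, tendsto_pure] at h2
  simpa using h2

theorem eventually_coeff_sum (d : ℕ →₀ ℕ) :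
    ∀ᶠ s in (atTop : Filter (Finset ℕ)),
      MvPowerSeries.coeff d (∑ j ∈ s, squareTerm j) =
        MvPowerSeries.coeff d (∑' j, squareTerm j) := by
  let _ : TopologicalSpace ℚ := ⊥
  have : DiscreteTopology ℚ := ⟨rfl⟩
  have h := summable_squareTerm.hasSum
  have h2 := (MvPowerSeries.WithPiTopology.tendsto_iff_coeff_tendsto _ _ _).1 h d
  rw [nhds_discrete, tendsto_pure] at h2
  simpa using h2

theorem constantCoeff_tsum_squareTerm : MvPowerSeries.constantCoeff (∑' j, squareTerm j) = 0 := by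
  obtain ⟨s, hs⟩ := (eventually_coeff_sum 0).exists
  rw [← MvPowerSeries.coeff_zero_eq_constantCoeff_apply, ← hs,
    MvPowerSeries.coeff_zero_eq_constantCoeff_apply, map_sum]
  refine Finset.sum_eq_zero fun j _ => ?_
  simp [squareTerm, t]

theorem hasSubst_tsum_squareTerm : PowerSeries.HasSubst (∑' j, squareTerm j) :=
  PowerSeries.HasSubst.of_constantCoeff_zero constantCoeff_tsum_squareTerm

theorem constantCoeff_subst_of_constantCoeff_eq_zero {a : Series}
    (ha : MvPowerSeries.constantCoeff a = 0) (f : PowerSeries ℚ) :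
    MvPowerSeries.constantCoeff (f.subst a) = PowerSeries.constantCoeff f := by
  rw [PowerSeries.constantCoeff_subst (PowerSeries.HasSubst.of_constantCoeff_zero ha),
    finsum_eq_single _ 0]
  · simp
  · intro n hn
    simp [ha, hn]

theorem constantCoeff_tprod_expFactor : MvPowerSeries.constantCoeff (∏' j, expFactor j) = 1 := by
  obtain ⟨s, hs⟩ := (eventually_coeff_prod 0).exists
  rw [← MvPowerSeries.coeff_zero_eq_constantCoeff_apply, ← hs,
    MvPowerSeries.coeff_zero_eq_constantCoeff_apply, map_prod]
  refine Finset.prod_eq_one fun j _ => ?_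
  rw [expFactor, constantCoeff_subst_of_constantCoeff_eq_zero (constantCoeff_t _)]
  simp

theorem pderiv_prod_expFactor (i : ℕ) (s : Finset ℕ) :
    MvPowerSeries.pderiv ℚ i (∏ j ∈ s, expFactor j) =
      if ∃ j ∈ s, 2 * j + 1 = i then ∏ j ∈ s, expFactor j else 0 := by
  classical
  induction s using Finset.induction_on with
  | empty => simp
  | insert k s hk ih =>
    rw [Finset.prod_insert hk, Derivation.leibniz, ih, pderiv_expFactor, smul_eq_mul, smul_eq_mul]
    by_cases h : 2 * k + 1 = i
    · have h' : ¬ ∃ j ∈ s, 2 * j + 1 = i := by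
        rintro ⟨j, hj, h2⟩
        exact hk (by rwa [show k = j by omega])
      rw [if_neg h', if_pos h, if_pos ⟨k, by simp, h⟩]; ring
    · rw [if_neg h]
      by_cases h' : ∃ j ∈ s, 2 * j + 1 = i
      · rw [if_pos h', if_pos (by simpa [h] using h')]; ring
      · rw [if_neg h', if_neg (by simpa [h] using h')]; ring

theorem pderiv_tprod_expFactor (i : ℕ) :
    MvPowerSeries.pderiv ℚ i (∏' j, expFactor j) = if Odd i then ∏' j, expFactor j else 0 := by
  ext d
  -- The coefficient of the derivative at `d` reads the product at `d + single i 1`, so both must be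
  -- stable; `i / 2` is the index of the factor in `t i` when `i` is odd.
  obtain ⟨s, h1, h2, h3⟩ := ((eventually_coeff_prod d).and ((eventually_coeff_prod
    (d + Finsupp.single i 1)).and (eventually_ge_atTop {i / 2}))).exists
  have h : (∃ j ∈ s, 2 * j + 1 = i) ↔ Odd i := by
    constructor
    · rintro ⟨j, -, rfl⟩
      exact ⟨j, rfl⟩
    · rintro ⟨j, rfl⟩
      refine ⟨j, ?_, rfl⟩
      have := h3 (Finset.mem_singleton_self _)
      rwa [show (2 * j + 1) / 2 = j by omega] at this
  have h4 := congrArg (MvPowerSeries.coeff d) (pderiv_prod_expFactor i s)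
  simp only [h] at h4
  rw [MvPowerSeries.coeff_pderiv, h2, ← MvPowerSeries.coeff_pderiv] at h4
  rw [h4]
  split_ifs <;> simp [h1]

theorem pderiv_tsum_squareTerm {i : ℕ} (hi : i ≠ 0) :
    MvPowerSeries.pderiv ℚ i (∑' j, squareTerm j) = (i : ℚ) • t i := by
  ext d
  -- Both `2 * j + 1 = i` and `2 * j + 2 = i` give `j = (i - 1) / 2`, the only term involving `t i`.
  obtain ⟨s, h2, h3⟩ := ((eventually_coeff_sum
    (d + Finsupp.single i 1)).and (eventually_ge_atTop {(i - 1) / 2})).exists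
  rw [MvPowerSeries.coeff_pderiv, ← h2, ← MvPowerSeries.coeff_pderiv, map_sum,
    Finset.sum_eq_single ((i - 1) / 2), pderiv_squareTerm, if_pos (by omega)]
  · intro j _ hj
    rw [pderiv_squareTerm, if_neg (by omega)]
  · intro h
    exact absurd (h3 (Finset.mem_singleton_self _)) h

/-! ### The recursion for the coefficients -/

/-- `evenRootSeries` and `oddRootSeries`, indexed by the sign. -/
noncomputable def rootSeries (u : ℤˣ) : Series :=
  if u = 1 then evenRootSeries else oddRootSeries

theorem pderiv_rootSeries {i : ℕ} (hi : i ≠ 0) (u : ℤˣ) :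
    MvPowerSeries.pderiv ℚ i (rootSeries u) =
      (if Odd i then rootSeries u else 0) + (i : ℚ) • (t i * rootSeries (-u)) := by
  have h1 : (-1 : ℤˣ) ≠ 1 := by decide
  rcases Int.units_eq_one_or u with rfl | rfl
  · simp only [rootSeries, if_true, h1, if_false, evenRootSeries, oddRootSeries]
    rw [Derivation.leibniz, pderiv_tprod_expFactor, pderiv_subst constantCoeff_tsum_squareTerm,
      pderiv_tsum_squareTerm hi, derivative_coshSeries]
    split_ifs <;> simp [smul_eq_mul] <;> ring_nf
  · simp only [rootSeries, if_true, h1, if_false, evenRootSeries, oddRootSeries, neg_neg]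
    rw [Derivation.leibniz, pderiv_tprod_expFactor, pderiv_subst constantCoeff_tsum_squareTerm,
      pderiv_tsum_squareTerm hi, derivative_sinhSeries]
    split_ifs <;> simp [smul_eq_mul] <;> ring_nf

theorem constantCoeff_rootSeries (u : ℤˣ) :
    MvPowerSeries.constantCoeff (rootSeries u) = if u = 1 then 1 else 0 := by
  rw [rootSeries]
  split_ifs
  · rw [evenRootSeries, map_mul, constantCoeff_tprod_expFactor,
      constantCoeff_subst_of_constantCoeff_eq_zero constantCoeff_tsum_squareTerm,
      ← PowerSeries.coeff_zero_eq_constantCoeff_apply]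
    simp [coshSeries]
  · rw [oddRootSeries, map_mul, constantCoeff_tprod_expFactor,
      constantCoeff_subst_of_constantCoeff_eq_zero constantCoeff_tsum_squareTerm,
      ← PowerSeries.coeff_zero_eq_constantCoeff_apply]
    simp [sinhSeries]

/-- The coefficient of `t^d / d!`. -/
noncomputable def expCoeff (d : ℕ →₀ ℕ) (F : Series) : ℚ :=
  (d.prod fun _ k => (k ! : ℚ)) * MvPowerSeries.coeff d F

theorem prod_factorial_add_single (d : ℕ →₀ ℕ) (i : ℕ) :
    ((d + Finsupp.single i 1).prod fun _ k => (k ! : ℚ)) =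
      (d.prod fun _ k => (k ! : ℚ)) * (d i + 1) := by
  have h : ∀ e : ℕ →₀ ℕ, (e.prod fun _ k => (k ! : ℚ)) =
      ((e i)! : ℚ) * ((e.erase i).prod fun _ k => (k ! : ℚ)) := fun e =>
    (Finsupp.mul_prod_erase' e i _ (by simp)).symm
  rw [h, h d, Finsupp.erase_add, Finsupp.erase_single, add_zero, Finsupp.add_apply,
    Finsupp.single_eq_same, Nat.factorial_succ]
  push_cast
  ring

/-- The truncated subtraction is harmless: when `d i = 0` the factor `d i` removes the term. -/
theorem expCoeff_rootSeries_add_single {i : ℕ} (hi : i ≠ 0) (d : ℕ →₀ ℕ) (u : ℤˣ) :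
    expCoeff (d + Finsupp.single i 1) (rootSeries u) =
      (if Odd i then expCoeff d (rootSeries u) else 0) +
        i * d i * expCoeff (d - Finsupp.single i 1) (rootSeries (-u)) := by
  have h := congrArg (MvPowerSeries.coeff d) (pderiv_rootSeries hi u)
  rw [MvPowerSeries.coeff_pderiv, map_add, MvPowerSeries.coeff_smul] at h
  have h2 : (d.prod fun _ k => (k ! : ℚ)) * MvPowerSeries.coeff d (t i * rootSeries (-u)) =
      d i * expCoeff (d - Finsupp.single i 1) (rootSeries (-u)) := by
    classical
    by_cases h0 : d i = 0
    · rw [h0, t, MvPowerSeries.X, MvPowerSeries.coeff_monomial_mul, if_neg]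
      · simp
      · intro hle
        have := hle i
        simp [h0] at this
    · obtain ⟨e, rfl⟩ : ∃ e, d = e + Finsupp.single i 1 :=
        ⟨d - Finsupp.single i 1, by
          rw [tsub_add_cancel_of_le]
          simpa using Nat.one_le_iff_ne_zero.2 h0⟩
      rw [mul_comm (t i), t, MvPowerSeries.X, MvPowerSeries.coeff_add_mul_monomial,
        prod_factorial_add_single, add_tsub_cancel_right, expCoeff]
      simp
      ring
  rw [expCoeff, prod_factorial_add_single]
  calc _ = (d.prod fun _ k => (k ! : ℚ)) *
        (MvPowerSeries.coeff (d + Finsupp.single i 1) (rootSeries u) * (d i + 1)) := by ring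
    _ = _ := by
      rw [h, mul_add, mul_left_comm, h2]
      split_ifs <;> simp [expCoeff, mul_assoc]

/-! ### Cycles described by minimal periods -/

section Orbits

variable {α : Type*}

theorem minimalPeriod_perm_pos [Finite α] (σ : Equiv.Perm α) (a : α) : 0 < Function.minimalPeriod σ a :=
  Function.minimalPeriod_pos_of_mem_periodicPts
    (Function.Injective.mem_periodicPts σ.injective a)

theorem perm_pow_apply_eq_iff_modEq [Fintype α] [DecidableEq α] (σ : Equiv.Perm α) (a : α) (m n : ℕ) :
    (σ ^ m) a = (σ ^ n) a ↔ m ≡ n [MOD Function.minimalPeriod σ a] := by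
  have h := fun k => Function.iterate_mod_minimalPeriod_eq (f := σ) (x := a) (n := k)
  have hpos := minimalPeriod_perm_pos σ a
  simp only [Equiv.Perm.iterate_eq_pow] at h
  rw [← h m, ← h n, ← Equiv.Perm.iterate_eq_pow, ← Equiv.Perm.iterate_eq_pow,
    Function.iterate_eq_iterate_iff_of_lt_minimalPeriod (Nat.mod_lt _ hpos) (Nat.mod_lt _ hpos)]
  rfl

theorem sameCycle_iff_exists_pow_lt [Fintype α] [DecidableEq α] (σ : Equiv.Perm α) (a x : α) :
    σ.SameCycle a x ↔ ∃ k < Function.minimalPeriod σ a, (σ ^ k) a = x := by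
  constructor
  · intro h
    obtain ⟨k, -, -, rfl⟩ := h.exists_pow_eq
    exact ⟨k % Function.minimalPeriod σ a, Nat.mod_lt _ (minimalPeriod_perm_pos σ a),
      (perm_pow_apply_eq_iff_modEq σ a _ _).2 (Nat.mod_modEq _ _)⟩
  · rintro ⟨k, -, rfl⟩
    exact ⟨k, by simp⟩

theorem card_sameCycle [Fintype α] [DecidableEq α] (σ : Equiv.Perm α) (a : α) :
    (Finset.univ.filter fun x => σ.SameCycle a x).card = Function.minimalPeriod σ a := by
  have : (Finset.univ.filter fun x => σ.SameCycle a x) =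
      (Finset.range (Function.minimalPeriod σ a)).image fun k => (σ ^ k) a := by
    ext x
    simp [sameCycle_iff_exists_pow_lt]
  rw [this, Finset.card_image_of_injOn, Finset.card_range]
  intro m hm n hn h
  simp only [Finset.coe_range, Set.mem_Iio] at hm hn
  exact Nat.ModEq.eq_of_lt_of_lt ((perm_pow_apply_eq_iff_modEq σ a m n).1 h) hm hn

theorem minimalPeriod_apply_of_commute {σ τ : Equiv.Perm α} (h : Commute τ σ) (x : α) :
    Function.minimalPeriod σ (τ x) = Function.minimalPeriod σ x := by
  refine Function.minimalPeriod_eq_minimalPeriod_iff.2 fun n => ?_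
  rw [Function.IsPeriodicPt, Function.IsPeriodicPt, Function.IsFixedPt, Function.IsFixedPt,
    Equiv.Perm.iterate_eq_pow, ← Equiv.Perm.mul_apply, ← (h.pow_right n).eq,
    Equiv.Perm.mul_apply, τ.injective.eq_iff]

theorem Equiv.Perm.SameCycle.minimalPeriod_eq [Fintype α] [DecidableEq α] {σ : Equiv.Perm α} {a x : α}
    (h : σ.SameCycle a x) : Function.minimalPeriod σ x = Function.minimalPeriod σ a := by
  obtain ⟨k, -, rfl⟩ := (sameCycle_iff_exists_pow_lt σ a x).1 h
  exact minimalPeriod_apply_of_commute ((Commute.refl σ).pow_left k) a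

theorem minimalPeriod_subtypePerm {σ : Equiv.Perm α} {p : α → Prop} (h : ∀ x, p (σ x) ↔ p x)
    (x : {x // p x}) :
    Function.minimalPeriod (σ.subtypePerm h) x = Function.minimalPeriod σ x := by
  refine Function.minimalPeriod_eq_minimalPeriod_iff.2 fun n => ?_
  rw [Function.IsPeriodicPt, Function.IsPeriodicPt, Function.IsFixedPt, Function.IsFixedPt,
    Equiv.Perm.iterate_eq_pow, Equiv.Perm.iterate_eq_pow, Equiv.Perm.subtypePerm_pow,
    Subtype.ext_iff]
  rfl

/-- Fixed points need no exception: there the cycle is the identity and -(-1)^1 = 1. -/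
theorem sign_cycleOf [Fintype α] [DecidableEq α] (σ : Equiv.Perm α) (a : α) :
    Equiv.Perm.sign (σ.cycleOf a) = -(-1) ^ Function.minimalPeriod σ a := by
  by_cases h : σ a = a
  · rw [(Equiv.Perm.cycleOf_eq_one_iff σ).2 h,
      Function.minimalPeriod_eq_one_iff_isFixedPt.2 h]
    simp
  · rw [(Equiv.Perm.isCycle_cycleOf σ h).sign, ← card_sameCycle]
    congr 3
    ext x
    simp [Equiv.Perm.mem_support_cycleOf_iff' h]

/-- Each `m`-cycle consists of `m` points of period `m`. Counting points rather than cycles makes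
restriction to an invariant subset easy. Since `cycleType` omits fixed points, `m = 1` is separate.
-/
theorem mul_count_partition [Fintype α] [DecidableEq α] (σ : Equiv.Perm α) {m : ℕ} (hm : m ≠ 0) :
    m * σ.partition.parts.count m =
      (Finset.univ.filter fun x => Function.minimalPeriod σ x = m).card := by
  rw [Equiv.Perm.parts_partition, Multiset.count_add, Multiset.count_replicate]
  by_cases h1 : m = 1
  · subst h1
    rw [Multiset.count_eq_zero_of_notMem
      (fun h => absurd (Equiv.Perm.two_le_of_mem_cycleType h) (by norm_num)), if_pos rfl,
      zero_add, one_mul, ← Finset.card_compl]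
    congr 1
    ext x
    simp [Function.minimalPeriod_eq_one_iff_isFixedPt, Function.IsFixedPt]
  · rw [if_neg (Ne.symm h1), add_zero, Equiv.Perm.cycleType_def, Multiset.count_map]
    have hU : (Finset.univ.filter fun x => Function.minimalPeriod σ x = m) =
        (σ.cycleFactorsFinset.filter fun c => m = c.support.card).biUnion
          Equiv.Perm.support := by
      ext x
      simp only [Finset.mem_filter, Finset.mem_univ, true_and, Finset.mem_biUnion]
      have hx : σ x ≠ x → (σ.cycleOf x).support.card = Function.minimalPeriod σ x := by
        intro h
        rw [← card_sameCycle]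
        congr 1
        ext y
        simp [Equiv.Perm.mem_support_cycleOf_iff' h]
      constructor
      · intro h
        have hne : σ x ≠ x := fun h' => h1
          (h.symm.trans (Function.minimalPeriod_eq_one_iff_isFixedPt.2 h'))
        exact ⟨σ.cycleOf x, ⟨Equiv.Perm.cycleOf_mem_cycleFactorsFinset_iff.2
          (Equiv.Perm.mem_support.2 hne), by rw [hx hne, h]⟩,
          (Equiv.Perm.mem_support_cycleOf_iff' hne).2 (Equiv.Perm.SameCycle.refl _ _)⟩
      · rintro ⟨c, ⟨hc, rfl⟩, hxc⟩
        have hne : σ x ≠ x := by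
          rw [← (Equiv.Perm.mem_cycleFactorsFinset_iff.1 hc).2 x hxc]
          exact Equiv.Perm.mem_support.1 hxc
        rw [← hx hne, Equiv.Perm.cycle_is_cycleOf hxc hc]
    rw [hU, Finset.card_biUnion, Finset.sum_congr rfl (g := fun _ => m), Finset.sum_const,
      smul_eq_mul, mul_comm]
    · rfl
    · intro c hc
      exact (Finset.mem_filter.1 hc).2.symm
    · intro c hc c' hc' hne
      exact Equiv.Perm.disjoint_iff_disjoint_support.1
        (Equiv.Perm.cycleFactorsFinset_pairwise_disjoint σ (Finset.mem_filter.1 hc).1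
          (Finset.mem_filter.1 hc').1 hne)

/-- The number of cycles of each length, fixed points included. -/
noncomputable def cycleCounts [Fintype α] [DecidableEq α] (σ : Equiv.Perm α) : ℕ →₀ ℕ :=
  Multiset.toFinsupp σ.partition.parts

theorem cycleCounts_zero_apply [Fintype α] [DecidableEq α] (σ : Equiv.Perm α) : cycleCounts σ 0 = 0 := by
  rw [cycleCounts, Multiset.toFinsupp_apply, Multiset.count_eq_zero]
  exact fun h => absurd (σ.partition.parts_pos h) (lt_irrefl 0)

theorem mul_cycleCounts_apply [Fintype α] [DecidableEq α] (σ : Equiv.Perm α) {m : ℕ} (hm : m ≠ 0) :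
    m * cycleCounts σ m =
      (Finset.univ.filter fun x => Function.minimalPeriod σ x = m).card :=
  mul_count_partition σ hm

theorem card_filter_minimalPeriod_subtypePerm [Fintype α] [DecidableEq α] {σ : Equiv.Perm α} {p : α → Prop}
    [DecidablePred p] (h : ∀ x, p (σ x) ↔ p x) (m : ℕ) :
    (Finset.univ.filter fun x => Function.minimalPeriod (σ.subtypePerm h) x = m).card =
      (Finset.univ.filter fun x => p x ∧ Function.minimalPeriod σ x = m).card := by
  simp only [minimalPeriod_subtypePerm]
  refine Finset.card_bij (fun x _ => x.1) ?_ ?_ ?_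
  · intro x hx
    simpa [x.2] using hx
  · intro x _ y _ hxy
    exact Subtype.ext hxy
  · intro x hx
    simp only [Finset.mem_filter, Finset.mem_univ, true_and] at hx
    exact ⟨⟨x, hx.1⟩, by simpa using hx.2, rfl⟩

/-- Removing a union of `k` cycles of length `i`. -/
theorem cycleCounts_eq_add_single [Fintype α] [DecidableEq α] {σ : Equiv.Perm α} {p : α → Prop} [DecidablePred p]
    (h : ∀ x, ¬ p (σ x) ↔ ¬ p x) {i k : ℕ} (hi : i ≠ 0)
    (hp : ∀ x, p x → Function.minimalPeriod σ x = i)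
    (hk : (Finset.univ.filter p).card = i * k) :
    cycleCounts σ = cycleCounts (σ.subtypePerm (p := fun x => ¬ p x) h) + Finsupp.single i k := by
  ext m
  by_cases hm : m = 0
  · subst hm
    simp [cycleCounts_zero_apply, hi]
  refine Nat.eq_of_mul_eq_mul_left (Nat.pos_of_ne_zero hm) ?_
  rw [Finsupp.add_apply, mul_add, mul_cycleCounts_apply _ hm, mul_cycleCounts_apply _ hm,
    card_filter_minimalPeriod_subtypePerm,
    ← Finset.card_filter_add_card_filter_not (s := Finset.univ.filter
      fun x => Function.minimalPeriod σ x = m) p, Finset.filter_filter, Finset.filter_filter,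
    add_comm]
  congr 1
  · congr 1
    ext x
    simp [and_comm]
  · rw [Finsupp.single_apply]
    split_ifs with him
    · subst him
      rw [← hk]
      congr 1
      ext x
      simpa using hp x
    · rw [mul_zero, Finset.card_eq_zero, Finset.filter_eq_empty_iff]
      rintro x - ⟨h1, h2⟩
      exact him ((hp x h2).symm.trans h1)

end Orbits

/-! ### Square roots on one cycle or on a pair of cycles -/

section SquareRoots

variable {α : Type*}

/-- The square roots of `σ` of sign `u`. -/
def signedSquareRoots [Fintype α] [DecidableEq α] (σ : Equiv.Perm α) (u : ℤˣ) : Finset (Equiv.Perm α) :=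
  {τ | τ ^ 2 = σ ∧ Equiv.Perm.sign τ = u}

theorem mem_signedSquareRoots [Fintype α] [DecidableEq α] {σ τ : Equiv.Perm α} {u : ℤˣ} :
    τ ∈ signedSquareRoots σ u ↔ τ ^ 2 = σ ∧ Equiv.Perm.sign τ = u := by
  simp [signedSquareRoots]

/-- Square roots prescribed on an invariant set correspond to square roots on the complement. -/
theorem card_signedSquareRoots_extending [Fintype α] [DecidableEq α] {σ ρ : Equiv.Perm α} {p : α → Prop} [DecidablePred p]
    (hσ : ∀ x, ¬ p (σ x) ↔ ¬ p x) (h1 : ∀ x, p x → p (ρ x)) (h2 : ∀ x, ¬ p x → ρ x = x)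
    (h3 : ∀ x, p x → ρ (ρ x) = σ x) (u : ℤˣ) :
    ((signedSquareRoots σ u).filter fun τ => ∀ x, p x → τ x = ρ x).card =
      (signedSquareRoots (σ.subtypePerm (p := fun x => ¬ p x) hσ) (Equiv.Perm.sign ρ * u)).card := by
  symm
  refine Finset.card_bij (fun τ _ => ρ * Equiv.Perm.ofSubtype τ) ?_ ?_ ?_
  · intro τ hτ
    rw [mem_signedSquareRoots] at hτ
    have hfix : ∀ x, p x → Equiv.Perm.ofSubtype τ x = x := fun x hx =>
      Equiv.Perm.ofSubtype_apply_of_not_mem τ (not_not.2 hx)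
    rw [Finset.mem_filter, mem_signedSquareRoots]
    refine ⟨⟨?_, ?_⟩, fun x hx => by rw [Equiv.Perm.mul_apply, hfix x hx]⟩
    · ext x
      simp only [pow_two, Equiv.Perm.mul_apply]
      by_cases hx : p x
      · rw [hfix x hx, hfix _ (h1 x hx), h3 x hx]
      · rw [Equiv.Perm.ofSubtype_apply_of_mem τ hx, h2 _ (τ ⟨x, hx⟩).2,
          Equiv.Perm.ofSubtype_apply_coe, h2 _ (τ (τ ⟨x, hx⟩)).2]
        have := congrArg Subtype.val (DFunLike.congr_fun hτ.1 ⟨x, hx⟩)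
        simpa [pow_two] using this
    · rw [Equiv.Perm.sign_mul, Equiv.Perm.sign_ofSubtype, hτ.2, ← mul_assoc, Int.units_mul_self,
        one_mul]
  · intro τ _ τ' _ h
    exact Equiv.Perm.ofSubtype_injective (mul_left_cancel h)
  · intro τ hτ
    rw [Finset.mem_filter, mem_signedSquareRoots] at hτ
    obtain ⟨⟨hsq, hsign⟩, hρ⟩ := hτ
    -- For surjectivity: `ρ⁻¹ * τ` fixes every point of `p`, hence restricts to the complement,
    -- where it agrees with `τ`.
    have hfix : ∀ x, p x → (ρ⁻¹ * τ) x = x := fun x hx => by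
      rw [Equiv.Perm.mul_apply, hρ x hx]; exact ρ.symm_apply_apply x
    have hinv : ∀ x, ¬ p ((ρ⁻¹ * τ) x) ↔ ¬ p x := by
      refine fun x => not_congr ⟨fun hx => ?_, fun hx => by rwa [hfix x hx]⟩
      rwa [← (ρ⁻¹ * τ).injective (hfix _ hx)]
    have hmul : ρ * Equiv.Perm.ofSubtype ((ρ⁻¹ * τ).subtypePerm (p := fun x => ¬ p x) hinv) = τ := by
      rw [Equiv.Perm.ofSubtype_subtypePerm (p := fun x => ¬ p x) hinv fun x hx hp => hx (hfix x hp),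
        mul_inv_cancel_left]
    have happ : ∀ x, ¬ p x → (ρ⁻¹ * τ) x = τ x := fun x hx => by
      rw [← h2 _ ((hinv x).2 hx), ← Equiv.Perm.mul_apply, mul_inv_cancel_left]
    refine ⟨(ρ⁻¹ * τ).subtypePerm (p := fun x => ¬ p x) hinv, ?_, hmul⟩
    rw [mem_signedSquareRoots]
    refine ⟨?_, ?_⟩
    · ext x
      rw [pow_two, Equiv.Perm.mul_apply, Equiv.Perm.subtypePerm_apply,
        Equiv.Perm.subtypePerm_apply, Equiv.Perm.subtypePerm_apply]
      have hx := happ x x.2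
      have hx2 := happ _ ((hinv x).2 x.2)
      show (ρ⁻¹ * τ) ((ρ⁻¹ * τ) x) = σ x
      rw [hx2, hx, ← hsq, pow_two, Equiv.Perm.mul_apply]
    · have := congrArg Equiv.Perm.sign hmul
      rw [Equiv.Perm.sign_mul, Equiv.Perm.sign_ofSubtype, hsign] at this
      rw [← this, ← mul_assoc, Int.units_mul_self, one_mul]

/-- Both `τ` and, on `p`, `ρ` commute with their common square `σ`, so agreement at one point
propagates along its cycle. -/
theorem eq_on_cycle_of_apply_eq [Fintype α] [DecidableEq α] {σ τ ρ : Equiv.Perm α} {p : α → Prop}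
    (hτ : τ ^ 2 = σ) (hp : ∀ x, p x → p (σ x)) (h1 : ∀ x, p x → p (ρ x))
    (h3 : ∀ x, p x → ρ (ρ x) = σ x) {a : α} (ha : p a) (h : τ a = ρ a) {x : α}
    (hx : σ.SameCycle a x) : τ x = ρ x := by
  obtain ⟨k, -, rfl⟩ := (sameCycle_iff_exists_pow_lt σ a x).1 hx
  suffices p ((σ ^ k) a) ∧ τ ((σ ^ k) a) = ρ ((σ ^ k) a) from this.2
  clear hx
  induction k with
  | zero => exact ⟨ha, h⟩
  | succ k ih =>
    rw [pow_succ', Equiv.Perm.mul_apply]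
    refine ⟨hp _ ih.1, ?_⟩
    have hc : ∀ y, τ (σ y) = σ (τ y) := fun y => by
      rw [← hτ, pow_two]; rfl
    rw [hc, ih.2, ← h3 _ ih.1, h3 _ (h1 _ ih.1)]

/-- On a cycle of length 2m+1 the power σ^(m+1) squares to σ^(2m+2) = σ. It is even because an
odd-length cycle is, so the sign is unchanged on the complement. -/
theorem card_signedSquareRoots_apply_eq_pow [Fintype α] [DecidableEq α] {σ : Equiv.Perm α} {a : α} {m : ℕ}
    (hm : Function.minimalPeriod σ a = 2 * m + 1)
    (hσ : ∀ x, ¬ σ.SameCycle a (σ x) ↔ ¬ σ.SameCycle a x) (u : ℤˣ) :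
    ((signedSquareRoots σ u).filter fun τ => τ a = (σ ^ (m + 1)) a).card =
      (signedSquareRoots (σ.subtypePerm (p := fun x => ¬ σ.SameCycle a x) hσ) u).card := by
  set ρ := σ.cycleOf a ^ (m + 1) with hρ
  have happ : ∀ x, σ.SameCycle a x → ρ x = (σ ^ (m + 1)) x := fun x hx => by
    rw [hρ, hx.cycleOf_eq, Equiv.Perm.cycleOf_pow_apply_self]
  have h1 : ∀ x, σ.SameCycle a x → σ.SameCycle a (ρ x) := fun x hx => by
    rwa [happ x hx, Equiv.Perm.sameCycle_pow_right]
  have h2 : ∀ x, ¬ σ.SameCycle a x → ρ x = x := fun x hx =>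
    Equiv.Perm.pow_apply_eq_self_of_apply_eq_self
      (Equiv.Perm.cycleOf_apply_of_not_sameCycle hx) _
  have h3 : ∀ x, σ.SameCycle a x → ρ (ρ x) = σ x := fun x hx => by
    rw [happ _ (h1 x hx), happ x hx, ← Equiv.Perm.mul_apply, ← pow_add]
    nth_rw 2 [← pow_one σ]
    rw [perm_pow_apply_eq_iff_modEq, hx.minimalPeriod_eq, hm,
      show m + 1 + (m + 1) = 1 + (2 * m + 1) by ring]
    exact Nat.add_modEq_right
  have hsign : Equiv.Perm.sign ρ = 1 := by
    rw [hρ, map_pow, sign_cycleOf, hm, Odd.neg_one_pow ⟨m, rfl⟩, neg_neg, one_pow]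
  have key := card_signedSquareRoots_extending hσ h1 h2 h3 u
  rw [hsign, one_mul] at key
  rw [← key]
  congr 1
  refine Finset.filter_congr fun τ hτ => ⟨fun h x hx => ?_, fun h => ?_⟩
  · exact eq_on_cycle_of_apply_eq (mem_signedSquareRoots.1 hτ).1
      (fun y hy => Equiv.Perm.sameCycle_apply_right.2 hy) h1 h3 (Equiv.Perm.SameCycle.refl _ _)
      (h.trans (happ a (Equiv.Perm.SameCycle.refl _ _)).symm) hx
  · rw [h a (Equiv.Perm.SameCycle.refl _ _), happ a (Equiv.Perm.SameCycle.refl _ _)]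

/-- Exchanges `σ ^ l a` and `σ ^ l b` for `l < j`. -/
def swapOrbits [DecidableEq α] (σ : Equiv.Perm α) (a b : α) : ℕ → Equiv.Perm α
  | 0 => 1
  | j + 1 => Equiv.swap ((σ ^ j) a) ((σ ^ j) b) * swapOrbits σ a b j

theorem pow_apply_ne_pow_apply {σ : Equiv.Perm α} {a b : α} (hab : ¬ σ.SameCycle a b) (k l : ℕ) :
    (σ ^ k) a ≠ (σ ^ l) b := by
  intro h
  refine hab ?_
  rw [← Equiv.Perm.sameCycle_pow_left (n := k), h, Equiv.Perm.sameCycle_pow_left]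

theorem sign_swapOrbits [Fintype α] [DecidableEq α] {σ : Equiv.Perm α} {a b : α} (hab : ¬ σ.SameCycle a b) (j : ℕ) :
    Equiv.Perm.sign (swapOrbits σ a b j) = (-1) ^ j := by
  induction j with
  | zero => simp [swapOrbits]
  | succ j ih =>
    rw [swapOrbits, Equiv.Perm.sign_mul, ih, Equiv.Perm.sign_swap (pow_apply_ne_pow_apply hab j j),
      pow_succ']

theorem swapOrbits_apply_of_forall_ne [DecidableEq α] {σ : Equiv.Perm α} {a b x : α} {j : ℕ}
    (hx : ∀ l < j, x ≠ (σ ^ l) a ∧ x ≠ (σ ^ l) b) : swapOrbits σ a b j x = x := by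
  induction j with
  | zero => rfl
  | succ j ih =>
    rw [swapOrbits, Equiv.Perm.mul_apply, ih fun l hl => hx l (by omega),
      Equiv.swap_apply_of_ne_of_ne (hx j (by omega)).1 (hx j (by omega)).2]

theorem swapOrbits_comm [DecidableEq α] (σ : Equiv.Perm α) (a b : α) (j : ℕ) :
    swapOrbits σ a b j = swapOrbits σ b a j := by
  induction j with
  | zero => rfl
  | succ j ih => rw [swapOrbits, swapOrbits, ih, Equiv.swap_comm]

theorem swapOrbits_pow_apply_of_lt [Fintype α] [DecidableEq α] {σ : Equiv.Perm α} {a b : α} (hab : ¬ σ.SameCycle a b)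
    (hper : Function.minimalPeriod σ b = Function.minimalPeriod σ a) {j : ℕ}
    (hj : j ≤ Function.minimalPeriod σ a) {l : ℕ} (hl : l < j) :
    swapOrbits σ a b j ((σ ^ l) a) = (σ ^ l) b := by
  induction j with
  | zero => omega
  | succ j ih =>
    have hinj : ∀ c, Function.minimalPeriod σ c = Function.minimalPeriod σ a → ∀ k k' : ℕ,
        k < j + 1 → k' < j + 1 → (σ ^ k) c = (σ ^ k') c → k = k' := by
      intro c hc k k' hk hk' h
      exact Nat.ModEq.eq_of_lt_of_lt ((perm_pow_apply_eq_iff_modEq σ c k k').1 h)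
        (by omega) (by omega)
    rw [swapOrbits, Equiv.Perm.mul_apply]
    by_cases hlj : l = j
    · subst hlj
      rw [swapOrbits_apply_of_forall_ne, Equiv.swap_apply_left]
      exact fun k hk => ⟨fun h => by have := hinj a rfl l k (by omega) (by omega) h; omega,
        pow_apply_ne_pow_apply hab l k⟩
    · rw [ih (by omega) (by omega), Equiv.swap_apply_of_ne_of_ne]
      · exact (pow_apply_ne_pow_apply hab j l).symm
      · exact fun h => hlj (hinj b hper l j (by omega) (by omega) h)

theorem swapOrbits_pow_apply [Fintype α] [DecidableEq α] {σ : Equiv.Perm α} {a b : α} (hab : ¬ σ.SameCycle a b)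
    (hper : Function.minimalPeriod σ b = Function.minimalPeriod σ a) (l : ℕ) :
    swapOrbits σ a b (Function.minimalPeriod σ a) ((σ ^ l) a) = (σ ^ l) b := by
  have h := swapOrbits_pow_apply_of_lt hab hper le_rfl
    (Nat.mod_lt l (minimalPeriod_perm_pos σ a))
  rw [(perm_pow_apply_eq_iff_modEq σ a _ l).2 (Nat.mod_modEq _ _)] at h
  rw [h, perm_pow_apply_eq_iff_modEq, hper]
  exact Nat.mod_modEq _ _

/-- From τ a = b follows τ b = σ a, which determines τ on both cycles. With i the common length, the
sign there is (-1)^i · (-(-1)^i) = -1 whatever the parity of i. -/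
theorem card_signedSquareRoots_apply_eq_of_not_sameCycle [Fintype α] [DecidableEq α] {σ : Equiv.Perm α} {a b : α}
    (hab : ¬ σ.SameCycle a b)
    (hper : Function.minimalPeriod σ b = Function.minimalPeriod σ a)
    (hσ : ∀ x, ¬ (σ.SameCycle a (σ x) ∨ σ.SameCycle b (σ x)) ↔
      ¬ (σ.SameCycle a x ∨ σ.SameCycle b x)) (u : ℤˣ) :
    ((signedSquareRoots σ u).filter fun τ => τ a = b).card =
      (signedSquareRoots (σ.subtypePerm
        (p := fun x => ¬ (σ.SameCycle a x ∨ σ.SameCycle b x)) hσ) (-u)).card := by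
  have hba : ¬ σ.SameCycle b a := fun h => hab h.symm
  -- Advancing along the cycle of `b` and then exchanging the orbits gives σ^l a ↦ σ^l b ↦ σ^(l+1)
  -- a.
  set ρ := swapOrbits σ a b (Function.minimalPeriod σ a) * σ.cycleOf b with hρ
  have hρa : ∀ l : ℕ, ρ ((σ ^ l) a) = (σ ^ l) b := fun l => by
    rw [hρ, Equiv.Perm.mul_apply, Equiv.Perm.cycleOf_apply_of_not_sameCycle,
      swapOrbits_pow_apply hab hper]
    rwa [Equiv.Perm.sameCycle_pow_right]
  have hρb : ∀ l : ℕ, ρ ((σ ^ l) b) = (σ ^ (l + 1)) a := fun l => by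
    rw [hρ, Equiv.Perm.mul_apply, Equiv.Perm.cycleOf_apply_apply_pow_self, ← hper,
      swapOrbits_comm, swapOrbits_pow_apply hba hper.symm]
  have hA : ∀ x, σ.SameCycle a x ∨ σ.SameCycle b x →
      ∃ l : ℕ, x = (σ ^ l) a ∨ x = (σ ^ l) b := by
    rintro x (hx | hx)
    · obtain ⟨l, -, rfl⟩ := (sameCycle_iff_exists_pow_lt σ a x).1 hx
      exact ⟨l, Or.inl rfl⟩
    · obtain ⟨l, -, rfl⟩ := (sameCycle_iff_exists_pow_lt σ b x).1 hx
      exact ⟨l, Or.inr rfl⟩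
  have h1 : ∀ x, σ.SameCycle a x ∨ σ.SameCycle b x →
      σ.SameCycle a (ρ x) ∨ σ.SameCycle b (ρ x) := by
    intro x hx
    obtain ⟨l, rfl | rfl⟩ := hA x hx
    · rw [hρa]; exact Or.inr (by rw [Equiv.Perm.sameCycle_pow_right])
    · rw [hρb]; exact Or.inl (by rw [Equiv.Perm.sameCycle_pow_right])
  have h2 : ∀ x, ¬ (σ.SameCycle a x ∨ σ.SameCycle b x) → ρ x = x := by
    intro x hx
    rw [hρ, Equiv.Perm.mul_apply,
      Equiv.Perm.cycleOf_apply_of_not_sameCycle fun h => hx (Or.inr h),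
      swapOrbits_apply_of_forall_ne]
    intro l _
    refine ⟨?_, ?_⟩
    · rintro rfl; exact hx (Or.inl (by rw [Equiv.Perm.sameCycle_pow_right]))
    · rintro rfl; exact hx (Or.inr (by rw [Equiv.Perm.sameCycle_pow_right]))
  have h3 : ∀ x, σ.SameCycle a x ∨ σ.SameCycle b x → ρ (ρ x) = σ x := by
    intro x hx
    obtain ⟨l, rfl | rfl⟩ := hA x hx
    · rw [hρa, hρb, pow_succ', Equiv.Perm.mul_apply]
    · rw [hρb, hρa, pow_succ', Equiv.Perm.mul_apply]
  have hsign : Equiv.Perm.sign ρ = -1 := by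
    rw [hρ, Equiv.Perm.sign_mul, sign_swapOrbits hab, sign_cycleOf, hper, mul_neg,
      Int.units_mul_self]
  have key := card_signedSquareRoots_extending hσ h1 h2 h3 u
  rw [hsign, neg_one_mul] at key
  rw [← key]
  congr 1
  have hρa0 : ρ a = b := hρa 0
  have hinv : ∀ x, σ.SameCycle a x ∨ σ.SameCycle b x →
      σ.SameCycle a (σ x) ∨ σ.SameCycle b (σ x) := fun x hx => by
    simpa [Equiv.Perm.sameCycle_apply_right] using hx
  have ha : σ.SameCycle a a ∨ σ.SameCycle b a := Or.inl (Equiv.Perm.SameCycle.refl _ _)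
  have hb : σ.SameCycle a b ∨ σ.SameCycle b b := Or.inr (Equiv.Perm.SameCycle.refl _ _)
  refine Finset.filter_congr fun τ hτ => ⟨fun h x hx => ?_, fun h => ?_⟩
  · have hτ2 := (mem_signedSquareRoots.1 hτ).1
    rcases hx with hx | hx
    · exact eq_on_cycle_of_apply_eq hτ2 hinv h1 h3 ha (h.trans hρa0.symm) hx
    · refine eq_on_cycle_of_apply_eq hτ2 hinv h1 h3 hb ?_ hx
      have : τ b = σ a := by rw [← h, ← hτ2, pow_two, Equiv.Perm.mul_apply]
      rw [this, ← hρa0, h3 a ha]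
  · rw [h a ha, hρa0]

/-- If τ a = σ^k a, then σ a = τ² a = σ^(2k) a, so 2k ≡ 1 modulo the period. The period is therefore
odd, and k is the inverse m+1 of 2 modulo 2m+1. -/
theorem odd_and_eq_of_sq_eq [Fintype α] [DecidableEq α] {σ τ : Equiv.Perm α} (hτ : τ ^ 2 = σ) {a : α}
    (h : σ.SameCycle a (τ a)) :
    ∃ m, Function.minimalPeriod σ a = 2 * m + 1 ∧ τ a = (σ ^ (m + 1)) a := by
  obtain ⟨k, -, hk⟩ := (sameCycle_iff_exists_pow_lt σ a (τ a)).1 h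
  have hc : Commute τ (σ ^ k) := by
    rw [← hτ]
    exact ((Commute.refl τ).pow_right 2).pow_right k
  have h1 : (σ ^ (2 * k)) a = (σ ^ 1) a := by
    rw [pow_one, ← hτ, pow_two τ, Equiv.Perm.mul_apply, ← hk, ← Equiv.Perm.mul_apply, hc.eq,
      Equiv.Perm.mul_apply, ← hk, ← Equiv.Perm.mul_apply, ← pow_add, two_mul, ← pow_two, hτ]
  rw [perm_pow_apply_eq_iff_modEq] at h1
  rcases Nat.even_or_odd' (Function.minimalPeriod σ a) with ⟨m, hm | hm⟩
  · rw [hm] at h1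
    have := h1.of_mul_right m
    simp [Nat.ModEq] at this
  · refine ⟨m, hm, ?_⟩
    rw [← hk, perm_pow_apply_eq_iff_modEq]
    rw [hm] at h1 ⊢
    refine Nat.ModEq.cancel_left_of_coprime (c := 2) (by simp) (h1.trans ?_)
    rw [show 2 * (m + 1) = 1 + (2 * m + 1) by ring]
    exact Nat.add_modEq_right.symm

end SquareRoots

/-! ### The recursion for square roots and the induction -/

/-- The roots are sorted by b = τ a. As τ commutes with σ, only points b of the same period as a
occur. -/
theorem card_signedSquareRoots_eq_sum {α : Type*} [Fintype α] [DecidableEq α]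
    (σ : Equiv.Perm α) (u : ℤˣ) (a : α) (hσa : ∀ x, ¬ σ.SameCycle a (σ x) ↔ ¬ σ.SameCycle a x)
    (hσab : ∀ b x, ¬ (σ.SameCycle a (σ x) ∨ σ.SameCycle b (σ x)) ↔
      ¬ (σ.SameCycle a x ∨ σ.SameCycle b x)) :
    (signedSquareRoots σ u).card =
      (if Odd (Function.minimalPeriod σ a) then
        (signedSquareRoots (σ.subtypePerm (p := fun x => ¬ σ.SameCycle a x) hσa) u).card else 0) +
      ∑ b with ¬ σ.SameCycle a b ∧ Function.minimalPeriod σ b = Function.minimalPeriod σ a,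
        (signedSquareRoots (σ.subtypePerm
          (p := fun x => ¬ (σ.SameCycle a x ∨ σ.SameCycle b x)) (hσab b)) (-u)).card := by
  rw [Finset.card_eq_sum_card_fiberwise (f := fun τ => τ a) (t := Finset.univ)
    (fun _ _ => Finset.mem_coe.2 (Finset.mem_univ _)),
    ← Finset.sum_filter_add_sum_filter_not _ (fun b => σ.SameCycle a b)]
  congr 1
  · split_ifs with hodd
    · obtain ⟨m, hm⟩ := hodd
      rw [← card_signedSquareRoots_apply_eq_pow hm hσa u]
      refine Finset.sum_eq_single _ ?_ ?_
      · intro b hb hne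
        rw [Finset.card_eq_zero, Finset.filter_eq_empty_iff]
        rintro τ hτ rfl
        obtain ⟨m', hm', h⟩ := odd_and_eq_of_sq_eq (mem_signedSquareRoots.1 hτ).1
          (Finset.mem_filter.1 hb).2
        rw [hm] at hm'
        exact hne (by rw [h, show m' = m by omega])
      · intro h
        exact absurd (Finset.mem_filter.2 ⟨Finset.mem_univ _, by
          rw [Equiv.Perm.sameCycle_pow_right]⟩) h
    · refine Finset.sum_eq_zero fun b hb => ?_
      rw [Finset.card_eq_zero, Finset.filter_eq_empty_iff]
      rintro τ hτ rfl
      obtain ⟨m, hm, -⟩ := odd_and_eq_of_sq_eq (mem_signedSquareRoots.1 hτ).1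
        (Finset.mem_filter.1 hb).2
      exact hodd ⟨m, hm⟩
  · rw [← Finset.filter_filter, Finset.sum_filter (p := fun b => _ = _)]
    refine Finset.sum_congr rfl fun b hb => ?_
    split_ifs with hper
    · exact card_signedSquareRoots_apply_eq_of_not_sameCycle (Finset.mem_filter.1 hb).2 hper _ u
    · rw [Finset.card_eq_zero, Finset.filter_eq_empty_iff]
      rintro τ hτ rfl
      refine hper (minimalPeriod_apply_of_commute ?_ a)
      rw [← (mem_signedSquareRoots.1 hτ).1]
      exact (Commute.refl τ).pow_right 2

theorem cycleCounts_eq_zero_of_isEmpty {α : Type*} [Fintype α] [DecidableEq α] [IsEmpty α]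
    (σ : Equiv.Perm α) : cycleCounts σ = 0 := by
  ext m
  by_cases hm : m = 0
  · subst hm
    exact cycleCounts_zero_apply σ
  · have h := mul_cycleCounts_apply σ hm
    rw [Finset.univ_eq_empty, Finset.filter_empty, Finset.card_empty] at h
    exact (Nat.mul_eq_zero.1 h).resolve_left hm

theorem card_signedSquareRoots_of_isEmpty {α : Type*} [Fintype α] [DecidableEq α] [IsEmpty α]
    (σ : Equiv.Perm α) (u : ℤˣ) :
    (signedSquareRoots σ u).card = if u = 1 then 1 else 0 := by
  split_ifs with h
  · rw [Finset.card_eq_one]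
    refine ⟨1, Finset.ext fun τ => ?_⟩
    simp [mem_signedSquareRoots, h, Subsingleton.elim τ 1, Subsingleton.elim σ 1]
  · rw [Finset.card_eq_zero, Finset.eq_empty_iff_forall_notMem]
    intro τ hτ
    rw [mem_signedSquareRoots, Subsingleton.elim τ 1, Equiv.Perm.sign_one] at hτ
    exact h hτ.2.symm

theorem card_signedSquareRoots_eq_expCoeff {α : Type*} [Fintype α] [DecidableEq α]
    (σ : Equiv.Perm α) (u : ℤˣ) :
    ((signedSquareRoots σ u).card : ℚ) = expCoeff (cycleCounts σ) (rootSeries u) := by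
  induction hn : Fintype.card α using Nat.strong_induction_on generalizing α u with
  | _ n ih =>
  rcases isEmpty_or_nonempty α with hα | ⟨⟨a⟩⟩
  · rw [card_signedSquareRoots_of_isEmpty, cycleCounts_eq_zero_of_isEmpty, expCoeff,
      MvPowerSeries.coeff_zero_eq_constantCoeff_apply, constantCoeff_rootSeries]
    simp
  subst hn
  have hi : Function.minimalPeriod σ a ≠ 0 := (minimalPeriod_perm_pos σ a).ne'
  have hσa : ∀ x, ¬ σ.SameCycle a (σ x) ↔ ¬ σ.SameCycle a x := by simp
  have hσab : ∀ b x, ¬ (σ.SameCycle a (σ x) ∨ σ.SameCycle b (σ x)) ↔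
      ¬ (σ.SameCycle a x ∨ σ.SameCycle b x) := by simp
  have hcyc := cycleCounts_eq_add_single (p := fun x => σ.SameCycle a x) (k := 1) hσa hi
    (fun x hx => hx.minimalPeriod_eq) (by rw [card_sameCycle, mul_one])
  rw [card_signedSquareRoots_eq_sum σ u a hσa hσab, hcyc, expCoeff_rootSeries_add_single hi,
    Nat.cast_add, Nat.cast_sum]
  congr 1
  · rw [Nat.cast_ite, Nat.cast_zero]
    congr 1
    exact ih _ (Fintype.card_subtype_lt (x := a)
      (not_not.2 (Equiv.Perm.SameCycle.refl _ _))) _ u rfl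
  -- The coefficient `i * d i` is the number of admissible `b`: points of period `i` outside the
  -- cycle of `a`. It remains to see that all summands are equal.
  · rw [← Nat.cast_mul, mul_cycleCounts_apply _ hi, card_filter_minimalPeriod_subtypePerm,
      ← nsmul_eq_mul]
    refine Finset.sum_eq_card_nsmul fun b hb => ?_
    obtain ⟨hab, hper⟩ := (Finset.mem_filter.1 hb).2
    have hdisj : Disjoint (Finset.univ.filter fun x => σ.SameCycle a x)
        (Finset.univ.filter fun x => σ.SameCycle b x) := by
      rw [Finset.disjoint_filter]
      exact fun x _ hax hbx => hab (hax.trans hbx.symm)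
    have hcyc2 := cycleCounts_eq_add_single (p := fun x => σ.SameCycle a x ∨ σ.SameCycle b x)
      (k := 2) (hσab b) hi
      (by
        rintro x (hx | hx)
        · exact hx.minimalPeriod_eq
        · exact hx.minimalPeriod_eq.trans hper)
      (by
        rw [Finset.filter_or, Finset.card_union_of_disjoint hdisj, card_sameCycle,
          card_sameCycle, hper, mul_two])
    rw [ih _ (Fintype.card_subtype_lt (x := a)
      (not_not.2 (Or.inl (Equiv.Perm.SameCycle.refl _ _)))) _ (-u) rfl]
    -- Comparing the removal of one cycle with that of two shows that the latter leaves the counts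
    -- `d - single i 1`.
    rw [hcyc, show (2 : ℕ) = 1 + 1 from rfl, Finsupp.single_add, ← add_assoc] at hcyc2
    rw [add_right_cancel hcyc2, add_tsub_cancel_right]

/-! ### From cycle vectors to cycle counts -/

theorem sum_single_eq_cycleCounts {n : ℕ} {c : Fin n → ℕ} {σ : Equiv.Perm (Fin n)}
    (h : HasCycleVector σ c) :
    ∑ i : Fin n, Finsupp.single ((i : ℕ) + 1) (c i) = cycleCounts σ := by
  ext m
  rw [Finsupp.finsetSum_apply]
  by_cases hm : ∃ i : Fin n, (i : ℕ) + 1 = m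
  · obtain ⟨i, rfl⟩ := hm
    rw [Finset.sum_eq_single i]
    · rw [Finsupp.single_eq_same, ← h i]
      rfl
    · intro j _ hj
      rw [Finsupp.single_apply, if_neg]
      exact fun h' => hj (Fin.ext (by omega))
    · simp
  · rw [Finset.sum_eq_zero]
    · by_cases h0 : m = 0
      · rw [h0, cycleCounts_zero_apply]
      · symm
        rw [cycleCounts, Multiset.toFinsupp_apply, Multiset.count_eq_zero]
        intro hmem
        -- No cycle is longer than `n`, so the indices `1, …, n` exhaust the cycle lengths.
        have hle := Multiset.single_le_sum (fun _ _ => Nat.zero_le _) m hmem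
        rw [σ.partition.parts_sum, Fintype.card_fin] at hle
        exact hm ⟨⟨m - 1, by omega⟩, by simp; omega⟩
    · intro i _
      rw [Finsupp.single_apply, if_neg fun h' => hm ⟨i, h'⟩]

theorem egfCoeff_eq_expCoeff {n : ℕ} {c : Fin n → ℕ} {σ : Equiv.Perm (Fin n)}
    (h : HasCycleVector σ c) (F : Series) : egfCoeff c F = expCoeff (cycleCounts σ) F := by
  have h1 := sum_single_eq_cycleCounts h
  rw [egfCoeff, expCoeff, h1]
  congr 1
  have hinj : Function.Injective fun i : Fin n => (i : ℕ) + 1 := fun i j hij =>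
    Fin.ext (by simpa using hij)
  have hsub : (cycleCounts σ).support ⊆ Finset.univ.image fun i : Fin n => (i : ℕ) + 1 := by
    rw [← h1]
    intro m hm
    by_contra hne
    rw [Finsupp.mem_support_iff, Finsupp.finsetSum_apply] at hm
    refine hm (Finset.sum_eq_zero fun i _ => ?_)
    rw [Finsupp.single_apply, if_neg]
    rintro rfl
    exact hne (Finset.mem_image_of_mem _ (Finset.mem_univ i))
  rw [Finsupp.prod_of_support_subset _ hsub _ (by simp), Finset.prod_image hinj.injOn]
  exact Finset.prod_congr rfl fun i _ => by rw [← h i]; rfl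

theorem evenSquareRoots_eq {n : ℕ} (σ : Equiv.Perm (Fin n)) :
    evenSquareRoots σ = signedSquareRoots σ 1 := rfl

theorem oddSquareRoots_eq {n : ℕ} (σ : Equiv.Perm (Fin n)) :
    oddSquareRoots σ = signedSquareRoots σ (-1) := rfl

/-- The infinite product and the infinite sum converge formally, the sum may be substituted into a
power series, and the resulting series count the even and the odd square roots. -/
theorem mainTheorem3 :
    Multipliable expFactor ∧ Summable squareTerm ∧
    PowerSeries.HasSubst (∑' j, squareTerm j) ∧
    ∀ (n : ℕ) (c : Fin n → ℕ) (σ : Equiv.Perm (Fin n)), HasCycleVector σ c →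
      egfCoeff c evenRootSeries = ((evenSquareRoots σ).card : ℚ) ∧
      egfCoeff c oddRootSeries = ((oddSquareRoots σ).card : ℚ) := by
  refine ⟨multipliable_expFactor, summable_squareTerm, hasSubst_tsum_squareTerm,
    fun n c σ h => ⟨?_, ?_⟩⟩
  · rw [egfCoeff_eq_expCoeff h, evenSquareRoots_eq, card_signedSquareRoots_eq_expCoeff,
      rootSeries, if_pos rfl]
  · rw [egfCoeff_eq_expCoeff h, oddSquareRoots_eq, card_signedSquareRoots_eq_expCoeff,
      rootSeries, if_neg (by decide)]
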